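/- Let $G$ be an infinite compact (Hausdorff) abelian group with normalized (regular) Haar measure $\mu$ on its Borel $\sigma$-algebra, and let $L^0(G)$ be the space of complex-valued Borel measurable functions on $G$, modulo equality $\mu$-a.e. A Banach function space over $G$ is a Banach space $(E,\|\cdot\|_E)$, where $E\subseteq L^0(G)$ is a linear subspace such that $f\in E$ whenever $f\in L^0(G)$, $g\in E$ and $|f|\le|g|$ a.e., and such that $\|f\|_E\le\|g\|_E$ whenever $f,g\in E$ and $|f|\le|g|$ a.e. It is translation invariant if for all $f\in E$ and $y\in G$ the function $\tau_yf(x)=f(x-y)$ belongs to $E$ and $\|\tau_yf\|_E=\|f\|_E$. Its Köthe dual is $E^\times=\{g\in L^0(G):\|g\|_{E^\times}<\infty\}$ with the norm $\|g\|_{E^\times}=\sup\{\int_G|fg|\,d\mu: f\in E,\ \|f\|_E\le1\}$. The space $E$ has the Fatou property if for every upwards directed net $0\le u_\alpha\uparrow$ in $E$ with $\sup_\alpha\|u_\alpha\|_E<\infty$ there is $u\in E$ with $u_\alpha\uparrow u$ and $\|u_\alpha\|_E\uparrow\|u\|_E$. Let $E\neq\{0\}$ be a translation invariant Banach function space over $G$.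 (i) With continuous inclusions, $L^\infty(G)\subseteq E^\times\subseteq L^1(G)$. (ii) If, in addition, $E$ has the Fatou property, then, with continuous inclusions, $L^\infty(G)\subseteq E\subseteq L^1(G)$. -/

import Mathlib

open MeasureTheory
open scoped ENNReal ComplexOrder

universe u

noncomputable section

/-- A linear space of (classes modulo a.e. equality of) complex measurable functions, together
with a seminorm on it. This is the common type of Banach function spaces, of the spaces `L^p` and
of Köthe duals. -/
structure SeminormedFunctionSpace {Ω : Type u} [MeasurableSpace Ω] (μ : Measure Ω) where
  toSubmodule : Submodule ℂ (Ω →ₘ[μ] ℂ)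
  seminorm : Seminorm ℂ toSubmodule

namespace SeminormedFunctionSpace

variable {Ω : Type u} [MeasurableSpace Ω] {μ : Measure Ω}

/-- The (semi)norm, metric and topology on the space that are given by its seminorm. -/
instance instSeminormedAddCommGroup (F : SeminormedFunctionSpace μ) :
    SeminormedAddCommGroup F.toSubmodule :=
  F.seminorm.toAddGroupSeminorm.toSeminormedAddCommGroup

theorem norm_def (F : SeminormedFunctionSpace μ) (f : F.toSubmodule) : ‖f‖ = F.seminorm f := rfl

instance instNormedSpace (F : SeminormedFunctionSpace μ) : NormedSpace ℂ F.toSubmodule where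
  norm_smul_le c f := (map_smul_eq_mul F.seminorm c f).le

/-- `E ⊆ F` with a continuous inclusion map. -/
def ContinuouslyIncluded (E F : SeminormedFunctionSpace μ) : Prop :=
  ∃ h : E.toSubmodule ≤ F.toSubmodule, Continuous (Submodule.inclusion h)

/-- `E` is a Banach function space over `(Ω, Σ, μ)`: an order ideal of `L⁰(μ)` with an absolutely
monotone norm for which it is complete. -/
structure IsBanachFunctionSpace (E : SeminormedFunctionSpace μ) : Prop where
  /-- The seminorm is a norm. -/
  eq_zero_of_norm_eq_zero : ∀ f : E.toSubmodule, ‖f‖ = 0 → f = 0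
  /-- The space is an order ideal. -/
  mem_of_abs_le : ∀ f g : Ω →ₘ[μ] ℂ,
    g ∈ E.toSubmodule → (∀ᵐ x ∂μ, ‖f x‖ ≤ ‖g x‖) → f ∈ E.toSubmodule
  /-- The norm is absolutely monotone. -/
  norm_le_of_abs_le : ∀ f g : E.toSubmodule,
    (∀ᵐ x ∂μ, ‖(f : Ω →ₘ[μ] ℂ) x‖ ≤ ‖(g : Ω →ₘ[μ] ℂ) x‖) → ‖f‖ ≤ ‖g‖
  /-- The space is complete. -/
  completeSpace : CompleteSpace E.toSubmodule

end SeminormedFunctionSpace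

section Lp

variable {Ω : Type u} [MeasurableSpace Ω]

/-- The space `L^p(μ)`, `1 ≤ p ≤ ∞`, with its usual norm. -/
def lpFunctionSpace (p : ℝ≥0∞) [Fact (1 ≤ p)] (μ : Measure Ω) : SeminormedFunctionSpace μ where
  toSubmodule := Lp.LpSubmodule ℂ ℂ p μ
  seminorm := Seminorm.of (fun f => (eLpNorm (f : Ω →ₘ[μ] ℂ) p μ).toReal)
    (fun f g => by
      have := norm_add_le (⟨f.1, f.2⟩ : Lp ℂ p μ) ⟨g.1, g.2⟩
      rwa [Lp.norm_def, Lp.norm_def, Lp.norm_def] at this)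
    (fun c f => by
      have := norm_smul c (⟨f.1, f.2⟩ : Lp ℂ p μ)
      rwa [Lp.norm_def, Lp.norm_def] at this)

end Lp

namespace SeminormedFunctionSpace

variable {Ω : Type u} [MeasurableSpace Ω] {μ : Measure Ω}

/-- `‖g‖_{E^×} = sup {∫ |f g| dμ : f ∈ E, ‖f‖_E ≤ 1} ∈ [0, ∞]`, for every `g ∈ L⁰(μ)`. -/
def kotheNorm (E : SeminormedFunctionSpace μ) (g : Ω →ₘ[μ] ℂ) : ℝ≥0∞ :=
  ⨆ (f : E.toSubmodule) (_ : ‖f‖ ≤ 1), ∫⁻ x, ‖(f : Ω →ₘ[μ] ℂ) x * g x‖ₑ ∂μ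

theorem kotheNorm_zero (E : SeminormedFunctionSpace μ) : E.kotheNorm 0 = 0 := by
  refine le_antisymm (iSup₂_le fun f _ => ?_) bot_le
  rw [lintegral_congr_ae (g := fun _ => 0)]
  · simp
  · filter_upwards [AEEqFun.coeFn_zero (α := Ω) (β := ℂ) (μ := μ)] with x hx
    simp [hx]

theorem kotheNorm_add_le (E : SeminormedFunctionSpace μ) (g h : Ω →ₘ[μ] ℂ) :
    E.kotheNorm (g + h) ≤ E.kotheNorm g + E.kotheNorm h := by
  refine iSup₂_le fun f hf => ?_
  calc ∫⁻ x, ‖(f : Ω →ₘ[μ] ℂ) x * (g + h : Ω →ₘ[μ] ℂ) x‖ₑ ∂μ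
      ≤ ∫⁻ x, (‖(f : Ω →ₘ[μ] ℂ) x * g x‖ₑ + ‖(f : Ω →ₘ[μ] ℂ) x * h x‖ₑ) ∂μ := by
        refine lintegral_mono_ae ?_
        filter_upwards [AEEqFun.coeFn_add g h] with x hx
        rw [hx, Pi.add_apply, mul_add]
        exact enorm_add_le _ _
    _ = ∫⁻ x, ‖(f : Ω →ₘ[μ] ℂ) x * g x‖ₑ ∂μ + ∫⁻ x, ‖(f : Ω →ₘ[μ] ℂ) x * h x‖ₑ ∂μ :=
        lintegral_add_left (((f : Ω →ₘ[μ] ℂ).measurable.mul g.measurable).enorm) _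
    _ ≤ E.kotheNorm g + E.kotheNorm h := by
        unfold kotheNorm
        gcongr
        · exact le_iSup₂ (f := fun (f : E.toSubmodule) (_ : ‖f‖ ≤ 1) =>
            ∫⁻ x, ‖(f : Ω →ₘ[μ] ℂ) x * g x‖ₑ ∂μ) f hf
        · exact le_iSup₂ (f := fun (f : E.toSubmodule) (_ : ‖f‖ ≤ 1) =>
            ∫⁻ x, ‖(f : Ω →ₘ[μ] ℂ) x * h x‖ₑ ∂μ) f hf

theorem kotheNorm_smul (E : SeminormedFunctionSpace μ) (c : ℂ) (g : Ω →ₘ[μ] ℂ) :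
    E.kotheNorm (c • g) = ‖c‖ₑ * E.kotheNorm g := by
  unfold kotheNorm
  simp_rw [ENNReal.mul_iSup]
  refine iSup_congr fun f => iSup_congr fun _ => ?_
  have hm : Measurable fun x => ‖(f : Ω →ₘ[μ] ℂ) x * g x‖ₑ :=
    ((f : Ω →ₘ[μ] ℂ).measurable.mul g.measurable).enorm
  rw [← lintegral_const_mul _ hm]
  refine lintegral_congr_ae ?_
  filter_upwards [AEEqFun.coeFn_smul c g] with x hx
  rw [hx, Pi.smul_apply, smul_eq_mul, ← enorm_mul]
  congr 1
  ring

/-- The Köthe dual `E^× = {g ∈ L⁰(μ) : ‖g‖_{E^×} < ∞}` with the norm `‖·‖_{E^×}`. -/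
def kotheDual (E : SeminormedFunctionSpace μ) : SeminormedFunctionSpace μ where
  toSubmodule :=
    { carrier := {g | E.kotheNorm g < ∞}
      add_mem' := fun {g h} hg hh =>
        (E.kotheNorm_add_le g h).trans_lt (ENNReal.add_lt_top.2 ⟨hg, hh⟩)
      zero_mem' := by
        change E.kotheNorm 0 < ∞
        rw [kotheNorm_zero]
        exact ENNReal.zero_lt_top
      smul_mem' := fun c g hg => by
        change E.kotheNorm (c • g) < ∞
        rw [kotheNorm_smul]
        exact ENNReal.mul_lt_top enorm_lt_top hg }
  seminorm := Seminorm.of (fun g => (E.kotheNorm (g : Ω →ₘ[μ] ℂ)).toReal)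
    (fun g h => by
      rw [← ENNReal.toReal_add (ne_of_lt g.2) (ne_of_lt h.2)]
      exact ENNReal.toReal_mono (ENNReal.add_ne_top.2 ⟨ne_of_lt g.2, ne_of_lt h.2⟩)
        (E.kotheNorm_add_le _ _))
    (fun c g => by
      change (E.kotheNorm (c • (g : Ω →ₘ[μ] ℂ))).toReal = _
      rw [kotheNorm_smul, ENNReal.toReal_mul, toReal_enorm])

/-- The Fatou property: every increasing net `0 ≤ v_i` in `E` with bounded norms has a supremum
`w ∈ E`, and `‖v_i‖ ↑ ‖w‖`. The order on `ℂ`-valued functions is `f ≤ g` iff `g - f` is real and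
nonnegative a.e.; index sets in the universe of `Ω` suffice, since the range of an
increasing net is itself a directed subset of `L⁰(μ)`. -/
def FatouProperty (E : SeminormedFunctionSpace μ) : Prop :=
  ∀ (ι : Type u) [Preorder ι] [IsDirectedOrder ι] [Nonempty ι] (v : ι → E.toSubmodule),
    (∀ i, (0 : Ω →ₘ[μ] ℂ) ≤ v i) →
    (∀ i j, i ≤ j → (v i : Ω →ₘ[μ] ℂ) ≤ v j) →
    BddAbove (Set.range fun i => ‖v i‖) →
    ∃ w : E.toSubmodule, IsLUB (Set.range fun i => (v i : Ω →ₘ[μ] ℂ)) w ∧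
      IsLUB (Set.range fun i => ‖v i‖) ‖w‖

end SeminormedFunctionSpace

section Translation

variable {G : Type u} [AddCommGroup G] [TopologicalSpace G] [IsTopologicalAddGroup G]
  [MeasurableSpace G] [BorelSpace G] {μ : Measure G} [μ.IsAddHaarMeasure]

/-- The translation operator `(τ_y f)(x) = f(x - y)` on `L⁰(G)`. -/
def translateL0 (y : G) (f : G →ₘ[μ] ℂ) : G →ₘ[μ] ℂ :=
  f.compMeasurePreserving (fun x => x - y) (measurePreserving_sub_right μ y)

/-- `τ_y f ∈ E` and `‖τ_y f‖_E = ‖f‖_E` for all `f ∈ E` and `y ∈ G`. -/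
def SeminormedFunctionSpace.TranslationInvariant (E : SeminormedFunctionSpace μ) : Prop :=
  ∀ (y : G) (f : E.toSubmodule),
    ∃ h : translateL0 y (f : G →ₘ[μ] ℂ) ∈ E.toSubmodule,
      ‖(⟨translateL0 y (f : G →ₘ[μ] ℂ), h⟩ : E.toSubmodule)‖ = ‖f‖

end Translation

end

/-!
Convex combinations of the translates of an integrable function `f` approximate, in `L¹(G)`, the
constant `∫ f`, and for `f ∈ E` their norms are at most `‖f‖`. On the other hand the unit ball of
a Banach function space over a probability space is bounded in measure. Together these bound
`|∫ f|` on the integrable part of the unit ball of `E`; after truncation this says that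
`1 ∈ E^×`, which gives `L^∞ ⊆ E^×` and, by Hölder's inequality, `E ⊆ L¹`. Now every element of
`E` is integrable, so averaging `|g|` for some `0 ≠ g ∈ E` produces a bounded sequence in `E`
that converges a.e. to `1`. Fatou's lemma for the integral then gives `E^× ⊆ L¹`, and the Fatou
property of `E` gives `1 ∈ E`, that is, `L^∞ ⊆ E`.
-/

open Filter Topology

theorem tendsto_iInf_add_atTop {α : Type*} [ConditionallyCompleteLinearOrder α] [DenselyOrdered α]
    [TopologicalSpace α] [OrderTopology α] {r : ℕ → α} {L : α} (h : Tendsto r atTop (𝓝 L)) :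
    Tendsto (fun n => ⨅ k, r (n + k)) atTop (𝓝 L) := by
  have hle (n : ℕ) : ⨅ k, r (n + k) ≤ r n :=
    ciInf_le (h.bddBelow_range.mono (Set.range_comp_subset_range (n + ·) r)) 0
  refine tendsto_order.2 ⟨fun b hb => ?_, fun b hb => ?_⟩
  · obtain ⟨b', hbb', hb'⟩ := exists_between hb
    obtain ⟨N, hN⟩ := eventually_atTop.1 (h.eventually_const_lt hb')
    filter_upwards [eventually_ge_atTop N] with n hn
    exact hbb'.trans_le (le_ciInf fun k => (hN _ (hn.trans (Nat.le_add_right n k))).le)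
  · filter_upwards [h.eventually_lt_const hb] with n hn
    exact (hle n).trans_lt hn

section MeasureSpace

variable {Ω : Type*} [MeasurableSpace Ω] {μ : Measure Ω}

theorem coeFn_sum_ae_eq {ι β : Type*} [AddCommMonoid β] [TopologicalSpace β] [ContinuousAdd β]
    (f : ι → Ω →ₘ[μ] β) (s : Finset ι) :
    ⇑(∑ i ∈ s, f i) =ᵐ[μ] fun x => ∑ i ∈ s, f i x := by
  classical
  induction s using Finset.induction_on with
  | empty => simpa using! AEEqFun.coeFn_zero
  | insert i s hi ih =>
    rw [Finset.sum_insert hi]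
    filter_upwards [AEEqFun.coeFn_add (f i) (∑ j ∈ s, f j), ih] with x hadd hx
    rw [hadd, Pi.add_apply, hx, Finset.sum_insert hi]

theorem lintegral_eq_iSup_lintegral_min_natCast {F : Ω → ℝ≥0∞} (hF : Measurable F) :
    ∫⁻ x, F x ∂μ = ⨆ n : ℕ, ∫⁻ x, min (F x) n ∂μ := by
  rw [← lintegral_iSup (fun n => hF.min measurable_const)
    fun m n hmn x => min_le_min_left _ (Nat.cast_le.2 hmn)]
  refine lintegral_congr fun x => ?_
  rw [← inf_iSup_eq, ENNReal.iSup_natCast, inf_top_eq]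

theorem lintegral_enorm_mul_one (f : Ω → ℂ) :
    ∫⁻ x, ‖f x * (1 : Ω →ₘ[μ] ℂ) x‖ₑ ∂μ = ∫⁻ x, ‖f x‖ₑ ∂μ := by
  refine lintegral_congr_ae ?_
  filter_upwards [AEEqFun.coeFn_one (α := Ω) (β := ℂ) (μ := μ)] with x hx
  rw [hx, Pi.one_apply, mul_one]

theorem tendsto_measure_lt_norm_atTop [IsFiniteMeasure μ] {β : Type*} [NormedAddCommGroup β]
    [MeasurableSpace β] [BorelSpace β] [CompleteSpace β] [SecondCountableTopology β] {f : Ω → β}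
    (hf : AEMeasurable f μ) :
    Tendsto (fun r : ℝ => μ {x | r < ‖f x‖}) atTop (𝓝 0) := by
  have h := tendsto_measure_norm_gt_of_isTightMeasureSet
    (isTightMeasureSet_singleton (μ := μ.map f))
  simpa only [Set.mem_singleton_iff, iSup_iSup_eq_left, Set.preimage_ofPred_eq,
    Measure.map_apply_of_aemeasurable hf (measurableSet_lt measurable_const measurable_norm)]
    using h

theorem norm_le_of_tendsto_ae_const [IsProbabilityMeasure μ] {β : Type*} [NormedAddCommGroup β]
    {f : ℕ → Ω → β} (hf : ∀ n, AEStronglyMeasurable (f n) μ) {c : β}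
    (hlim : ∀ᵐ x ∂μ, Tendsto (fun n => f n x) atTop (𝓝 c)) {ε : ℝ≥0∞} (hε : ε < 1) {M : ℝ}
    (hM : ∀ n, μ {x | M < ‖f n x‖} ≤ ε) : ‖c‖ ≤ M := by
  by_contra! hlt
  have hconv := tendstoInMeasure_iff_norm.1 (tendstoInMeasure_of_tendsto_ae hf hlim) _
    (sub_pos.2 hlt)
  have hcover (n : ℕ) : 1 ≤ ε + μ {x | ‖c‖ - M ≤ ‖f n x - c‖} := by
    have hunion : {x | M < ‖f n x‖} ∪ {x | ‖c‖ - M ≤ ‖f n x - c‖} = Set.univ := by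
      refine Set.eq_univ_of_forall fun x => or_iff_not_imp_left.2 fun hx => ?_
      rw [Set.mem_ofPred_eq, not_lt] at hx
      have := norm_sub_norm_le c (f n x)
      rw [norm_sub_rev] at this
      exact (sub_le_sub_left hx _).trans this
    calc (1 : ℝ≥0∞) = μ ({x | M < ‖f n x‖} ∪ {x | ‖c‖ - M ≤ ‖f n x - c‖}) := by
          rw [hunion, measure_univ]
      _ ≤ μ {x | M < ‖f n x‖} + μ {x | ‖c‖ - M ≤ ‖f n x - c‖} := measure_union_le _ _
      _ ≤ ε + μ {x | ‖c‖ - M ≤ ‖f n x - c‖} := by gcongr; exact hM n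
  have hlimit := ge_of_tendsto' (tendsto_const_nhds.add hconv) hcover
  exact hε.not_ge (by simpa only [add_zero] using hlimit)

end MeasureSpace

section Averaging

variable {G : Type*} [AddCommGroup G] [TopologicalSpace G] [IsTopologicalAddGroup G]
  [MeasurableSpace G] [BorelSpace G] {μ : Measure G} [μ.IsAddHaarMeasure]

/-- The translation operator `(τ_y f)(x) = f(x - y)`, as an isometry of `L^p(G)`. Its underlying
map on `L⁰(G)` is `translateL0 y`. -/
noncomputable def translateLp {p : ℝ≥0∞} [Fact (1 ≤ p)] (y : G) : Lp ℂ p μ →ₗᵢ[ℂ] Lp ℂ p μ :=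
  Lp.compMeasurePreservingₗᵢ ℂ (fun x => x - y) (measurePreserving_sub_right μ y)

theorem continuous_translateLp [WeaklyLocallyCompactSpace G] [μ.Regular] {p : ℝ≥0∞}
    [Fact (1 ≤ p)] (hp : p ≠ ∞) (f : Lp ℂ p μ) : Continuous fun y : G => translateLp y f := by
  let sub : C(G, C(G, G)) := ContinuousMap.curry ⟨fun q => q.2 - q.1, by fun_prop⟩
  exact (continuous_const (y := f)).compMeasurePreservingLp sub.continuous
    (fun y => measurePreserving_sub_right μ y) hp

variable [CompactSpace G]

theorem integrable_translateLp [μ.Regular] {p : ℝ≥0∞} [Fact (1 ≤ p)] (hp : p ≠ ∞)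
    (f : Lp ℂ p μ) : Integrable (fun y : G => translateLp y f) μ :=
  (continuous_translateLp hp f).integrable_of_hasCompactSupport (.of_compactSpace _)

variable [IsProbabilityMeasure μ]

theorem integral_translateLp_toLp (φ : C(G, ℂ)) :
    ∫ y, translateLp y (ContinuousMap.toLp 1 μ ℂ φ) ∂μ = Lp.const 1 μ (∫ x, φ x ∂μ) := by
  let Φ : C(G, C(G, ℂ)) := ContinuousMap.curry ⟨fun q => φ (q.2 - q.1), by fun_prop⟩
  have hΦ : Integrable Φ μ := Φ.continuous.integrable_of_hasCompactSupport (.of_compactSpace _)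
  have hmean : ∫ y, Φ y ∂μ = ContinuousMap.const G (∫ x, φ x ∂μ) := by
    ext x
    rw [ContinuousMap.integral_apply hΦ]
    exact integral_sub_left_eq_self φ μ x
  calc ∫ y, translateLp y (ContinuousMap.toLp 1 μ ℂ φ) ∂μ
      = ∫ y, ContinuousMap.toLp 1 μ ℂ (Φ y) ∂μ := rfl
    _ = ContinuousMap.toLp 1 μ ℂ (∫ y, Φ y ∂μ) := ContinuousLinearMap.integral_comp_comm _ hΦ
    _ = Lp.const 1 μ (∫ x, φ x ∂μ) := by rw [hmean]; rfl

variable [μ.Regular]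

theorem continuous_integral_translateLp {p : ℝ≥0∞} [Fact (1 ≤ p)] (hp : p ≠ ∞) :
    Continuous fun f : Lp ℂ p μ => ∫ y, translateLp y f ∂μ := by
  refine LipschitzWith.continuous (K := 1) (LipschitzWith.of_dist_le_mul fun f g => ?_)
  rw [NNReal.coe_one, one_mul, dist_eq_norm, dist_eq_norm,
    ← integral_sub (integrable_translateLp hp f) (integrable_translateLp hp g)]
  calc ‖∫ y, (translateLp y f - translateLp y g) ∂μ‖ ≤ ‖f - g‖ * μ.real Set.univ :=
        norm_integral_le_of_norm_le_const (ae_of_all _ fun y => by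
          rw [← map_sub, LinearIsometry.norm_map])
    _ = ‖f - g‖ := by rw [probReal_univ, mul_one]

theorem integral_translateLp (f : Lp ℂ 1 μ) :
    ∫ y, translateLp y f ∂μ = Lp.const 1 μ (∫ x, f x ∂μ) := by
  have hconst : Continuous fun f : Lp ℂ 1 μ => Lp.const 1 μ (∫ x, f x ∂μ) :=
    (Lp.constL 1 μ ℂ (E := ℂ)).continuous.comp continuous_integral
  refine congrFun ((ContinuousMap.toLp_denseRange ℂ μ ℂ ENNReal.one_ne_top).equalizer
    (continuous_integral_translateLp ENNReal.one_ne_top) hconst (funext fun φ => ?_)) f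
  simp only [Function.comp_apply, integral_translateLp_toLp,
    integral_congr_ae (ContinuousMap.coeFn_toLp (p := 1) (𝕜 := ℂ) μ φ)]

theorem const_integral_mem_closure {S : Set (Lp ℂ 1 μ)} (hS : Convex ℝ S) {f : Lp ℂ 1 μ}
    (hf : ∀ y, translateLp y f ∈ S) : Lp.const 1 μ (∫ x, f x ∂μ) ∈ closure S := by
  rw [← integral_translateLp]
  exact hS.closure.integral_mem isClosed_closure (ae_of_all _ fun y => subset_closure (hf y))
    (integrable_translateLp ENNReal.one_ne_top f)

end Averaging

namespace SeminormedFunctionSpace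

section Solid

variable {Ω : Type u} [MeasurableSpace Ω] {μ : Measure Ω} {E F : SeminormedFunctionSpace μ}

/-- `E` is solid: an order ideal of `L⁰(μ)` whose seminorm is absolutely monotone. Unlike
`IsBanachFunctionSpace` this includes all Köthe duals. -/
def IsSolid (E : SeminormedFunctionSpace μ) : Prop :=
  ∀ (f : Ω →ₘ[μ] ℂ) (g : E.toSubmodule), (∀ᵐ x ∂μ, ‖f x‖ ≤ ‖(g : Ω →ₘ[μ] ℂ) x‖) →
    ∃ hf : f ∈ E.toSubmodule, ‖(⟨f, hf⟩ : E.toSubmodule)‖ ≤ ‖g‖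

theorem IsBanachFunctionSpace.isSolid (hB : E.IsBanachFunctionSpace) : E.IsSolid :=
  fun f g h => ⟨hB.mem_of_abs_le f g g.2 h, hB.norm_le_of_abs_le ⟨f, _⟩ g h⟩

theorem IsSolid.exists_coeFn_ae_eq (hE : E.IsSolid) {φ : Ω → ℂ} (hφ : AEStronglyMeasurable φ μ)
    (g : E.toSubmodule) (h : ∀ᵐ x ∂μ, ‖φ x‖ ≤ ‖(g : Ω →ₘ[μ] ℂ) x‖) :
    ∃ f : E.toSubmodule, (f : Ω →ₘ[μ] ℂ) =ᵐ[μ] φ ∧ ‖f‖ ≤ ‖g‖ := by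
  have hmk := AEEqFun.coeFn_mk φ hφ
  obtain ⟨hmem, hle⟩ := hE (AEEqFun.mk φ hφ) g (by
    filter_upwards [hmk, h] with x hx hx'
    rwa [hx])
  exact ⟨⟨_, hmem⟩, hmk, hle⟩

theorem IsSolid.exists_coeFn_ae_eq_norm (hE : E.IsSolid) (g : E.toSubmodule) :
    ∃ f : E.toSubmodule,
      (f : Ω →ₘ[μ] ℂ) =ᵐ[μ] (fun x => (‖(g : Ω →ₘ[μ] ℂ) x‖ : ℂ)) ∧ ‖f‖ ≤ ‖g‖ :=
  hE.exists_coeFn_ae_eq (Complex.continuous_ofReal.comp_aestronglyMeasurable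
    (g : Ω →ₘ[μ] ℂ).aestronglyMeasurable.norm) g
    (ae_of_all _ fun x => by rw [Complex.norm_real, norm_norm])

theorem IsSolid.lintegral_enorm_le_of_forall_norm_integral_le [IsFiniteMeasure μ]
    (hE : E.IsSolid) {M : ℝ}
    (hM : ∀ f : E.toSubmodule, ‖f‖ ≤ 1 → Integrable (f : Ω →ₘ[μ] ℂ) μ →
      ‖∫ x, (f : Ω →ₘ[μ] ℂ) x ∂μ‖ ≤ M)
    {f : E.toSubmodule} (hf : ‖f‖ ≤ 1) :
    ∫⁻ x, ‖(f : Ω →ₘ[μ] ℂ) x‖ₑ ∂μ ≤ ENNReal.ofReal M := by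
  rw [lintegral_eq_iSup_lintegral_min_natCast (f : Ω →ₘ[μ] ℂ).measurable.enorm]
  refine iSup_le fun n => ?_
  let φ : Ω → ℝ := fun x => min ‖(f : Ω →ₘ[μ] ℂ) x‖ n
  have hφ_nonneg (x) : 0 ≤ φ x := le_min (norm_nonneg _) n.cast_nonneg
  have hφ_meas : Measurable φ := (f : Ω →ₘ[μ] ℂ).measurable.norm.min measurable_const
  have hφ_int : Integrable φ μ := .of_bound hφ_meas.aestronglyMeasurable n
    (ae_of_all _ fun x => by
      rw [Real.norm_of_nonneg (hφ_nonneg x)]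
      exact min_le_right _ _)
  obtain ⟨h, hh, hhf⟩ := hE.exists_coeFn_ae_eq
    (Complex.continuous_ofReal.comp_aestronglyMeasurable hφ_meas.aestronglyMeasurable) f
    (ae_of_all _ fun x => by
      rw [Complex.norm_of_nonneg (hφ_nonneg x)]
      exact min_le_left _ _)
  calc ∫⁻ x, min ‖(f : Ω →ₘ[μ] ℂ) x‖ₑ n ∂μ = ∫⁻ x, ENNReal.ofReal (φ x) ∂μ :=
        lintegral_congr fun x => by rw [ENNReal.ofReal_min, ofReal_norm, ENNReal.ofReal_natCast]
    _ = ENNReal.ofReal (∫ x, φ x ∂μ) :=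
        (ofReal_integral_eq_lintegral_ofReal hφ_int (ae_of_all _ hφ_nonneg)).symm
    _ = ENNReal.ofReal ‖∫ x, (h : Ω →ₘ[μ] ℂ) x ∂μ‖ := by
        rw [integral_congr_ae hh, integral_complex_ofReal,
          Complex.norm_of_nonneg (integral_nonneg hφ_nonneg)]
    _ ≤ ENNReal.ofReal M := ENNReal.ofReal_le_ofReal
        (hM h (hhf.trans hf) (hφ_int.ofReal.congr hh.symm))

theorem ae_norm_le_norm_lpFunctionSpace_top (g : (lpFunctionSpace ∞ μ).toSubmodule) :
    ∀ᵐ x ∂μ, ‖(g : Ω →ₘ[μ] ℂ) x‖ ≤ ‖g‖ := by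
  filter_upwards [ae_le_eLpNormEssSup (f := (g : Ω →ₘ[μ] ℂ)) (μ := μ)] with x hx
  rw [← eLpNorm_exponent_top] at hx
  have h := ENNReal.toReal_mono (Lp.mem_Lp_iff_eLpNorm_lt_top.1 g.2).ne hx
  rwa [toReal_enorm] at h

theorem continuouslyIncluded_of_bound (h : E.toSubmodule ≤ F.toSubmodule) (C : ℝ)
    (hC : ∀ f : E.toSubmodule, ‖Submodule.inclusion h f‖ ≤ C * ‖f‖) :
    E.ContinuouslyIncluded F :=
  ⟨h, AddMonoidHomClass.continuous_of_bound (Submodule.inclusion h) C hC⟩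

theorem IsSolid.lpFunctionSpace_top_continuouslyIncluded (hE : E.IsSolid)
    (h1 : (1 : Ω →ₘ[μ] ℂ) ∈ E.toSubmodule) : (lpFunctionSpace ∞ μ).ContinuouslyIncluded E := by
  let one : E.toSubmodule := ⟨1, h1⟩
  have hle (g : (lpFunctionSpace ∞ μ).toSubmodule) := hE g ((‖g‖ : ℂ) • one) (by
    filter_upwards [ae_norm_le_norm_lpFunctionSpace_top g,
      AEEqFun.coeFn_smul (‖g‖ : ℂ) (1 : Ω →ₘ[μ] ℂ),
      AEEqFun.coeFn_one (α := Ω) (β := ℂ) (μ := μ)] with x hx hsmul hone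
    simpa [one, hsmul, hone] using hx)
  refine continuouslyIncluded_of_bound (fun g hg => (hle ⟨g, hg⟩).1) ‖one‖ fun g => ?_
  calc ‖Submodule.inclusion _ g‖ ≤ ‖(‖g‖ : ℂ) • one‖ := (hle g).2
    _ = ‖one‖ * ‖g‖ := by rw [norm_smul, Complex.norm_real, norm_norm, mul_comm]

theorem continuouslyIncluded_lpFunctionSpace_one {C : ℝ≥0∞} (hC : C ≠ ∞)
    (h : ∀ f : E.toSubmodule, ∫⁻ x, ‖(f : Ω →ₘ[μ] ℂ) x‖ₑ ∂μ ≤ C * ‖f‖ₑ) :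
    E.ContinuouslyIncluded (lpFunctionSpace 1 μ) := by
  simp_rw [← eLpNorm_one_eq_lintegral_enorm] at h
  have hfin (f : E.toSubmodule) : C * ‖f‖ₑ < ∞ := ENNReal.mul_lt_top hC.lt_top enorm_lt_top
  refine continuouslyIncluded_of_bound
    (fun f hf => Lp.mem_Lp_iff_eLpNorm_lt_top.2 ((h ⟨f, hf⟩).trans_lt (hfin _))) C.toReal
    fun f => ?_
  rw [← toReal_enorm f, ← ENNReal.toReal_mul]
  exact ENNReal.toReal_mono (hfin f).ne (h f)

end Solid

section KotheDual

variable {Ω : Type u} [MeasurableSpace Ω] {μ : Measure Ω} {E : SeminormedFunctionSpace μ}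

theorem enorm_kotheDual (g : E.kotheDual.toSubmodule) :
    ‖g‖ₑ = E.kotheNorm (g : Ω →ₘ[μ] ℂ) := by
  rw [← ofReal_norm]
  exact ENNReal.ofReal_toReal g.2.ne

theorem kotheNorm_mono {f g : Ω →ₘ[μ] ℂ} (h : ∀ᵐ x ∂μ, ‖f x‖ ≤ ‖g x‖) :
    E.kotheNorm f ≤ E.kotheNorm g := by
  refine iSup₂_mono fun e _ => lintegral_mono_ae ?_
  filter_upwards [h] with x hx
  rw [enorm_mul, enorm_mul]
  gcongr
  exact enorm_le_iff_norm_le.2 hx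

theorem isSolid_kotheDual (E : SeminormedFunctionSpace μ) : E.kotheDual.IsSolid :=
  fun _ g h => ⟨(kotheNorm_mono h).trans_lt g.2, ENNReal.toReal_mono g.2.ne (kotheNorm_mono h)⟩

theorem lintegral_enorm_mul_le_kotheNorm {f : E.toSubmodule} (hf : ‖f‖ ≤ 1) (g : Ω →ₘ[μ] ℂ) :
    ∫⁻ x, ‖(f : Ω →ₘ[μ] ℂ) x * g x‖ₑ ∂μ ≤ E.kotheNorm g :=
  le_iSup₂ (f := fun (f : E.toSubmodule) (_ : ‖f‖ ≤ 1) =>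
    ∫⁻ x, ‖(f : Ω →ₘ[μ] ℂ) x * g x‖ₑ ∂μ) f hf

theorem lintegral_enorm_mul_le_ofReal_mul {f : E.toSubmodule} {r : ℝ} (hr : ‖f‖ < r)
    (g : Ω →ₘ[μ] ℂ) :
    ∫⁻ x, ‖(f : Ω →ₘ[μ] ℂ) x * g x‖ₑ ∂μ ≤ ENNReal.ofReal r * E.kotheNorm g := by
  have hr0 : 0 < r := (norm_nonneg f).trans_lt hr
  have hunit : ‖((r⁻¹ : ℝ) : ℂ) • f‖ ≤ 1 := by
    rw [norm_smul, Complex.norm_real, Real.norm_of_nonneg (by positivity), inv_mul_le_one₀ hr0]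
    exact hr.le
  calc ∫⁻ x, ‖(f : Ω →ₘ[μ] ℂ) x * g x‖ₑ ∂μ
      = ∫⁻ x, ENNReal.ofReal r *
          ‖((((r⁻¹ : ℝ) : ℂ) • f : E.toSubmodule) : Ω →ₘ[μ] ℂ) x * g x‖ₑ ∂μ := by
        refine lintegral_congr_ae ?_
        filter_upwards [AEEqFun.coeFn_smul ((r⁻¹ : ℝ) : ℂ) (f : Ω →ₘ[μ] ℂ)] with x hx
        rw [Submodule.coe_smul, hx, Pi.smul_apply, smul_mul_assoc, enorm_smul, ← mul_assoc,
          ← ofReal_norm ((r⁻¹ : ℝ) : ℂ), Complex.norm_real, Real.norm_of_nonneg (by positivity),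
          ← ENNReal.ofReal_mul hr0.le, mul_inv_cancel₀ hr0.ne', ENNReal.ofReal_one, one_mul]
    _ = ENNReal.ofReal r *
          ∫⁻ x, ‖((((r⁻¹ : ℝ) : ℂ) • f : E.toSubmodule) : Ω →ₘ[μ] ℂ) x * g x‖ₑ ∂μ :=
        lintegral_const_mul _ ((AEEqFun.measurable _).mul g.measurable).enorm
    _ ≤ ENNReal.ofReal r * E.kotheNorm g := by
        gcongr
        exact lintegral_enorm_mul_le_kotheNorm hunit g

theorem lintegral_enorm_mul_le (f : E.toSubmodule) (g : E.kotheDual.toSubmodule) :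
    ∫⁻ x, ‖(f : Ω →ₘ[μ] ℂ) x * (g : Ω →ₘ[μ] ℂ) x‖ₑ ∂μ ≤ ‖f‖ₑ * ‖g‖ₑ := by
  -- Since `‖f‖` may be `0`, we scale `f` by `r⁻¹` for `r > ‖f‖` and let `r` tend to `‖f‖`.
  have hlim : Tendsto (fun r : ℝ => ENNReal.ofReal r * ‖g‖ₑ) (𝓝[>] ‖f‖) (𝓝 (‖f‖ₑ * ‖g‖ₑ)) := by
    rw [← ofReal_norm f]
    exact ENNReal.Tendsto.mul_const
      ENNReal.continuous_ofReal.continuousWithinAt.tendsto (.inr enorm_ne_top)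
  refine ge_of_tendsto hlim ?_
  filter_upwards [self_mem_nhdsWithin] with r hr
  rw [enorm_kotheDual]
  exact lintegral_enorm_mul_le_ofReal_mul hr g

theorem lintegral_enorm_le_of_one_mem_kotheDual (h1 : (1 : Ω →ₘ[μ] ℂ) ∈ E.kotheDual.toSubmodule)
    (f : E.toSubmodule) :
    ∫⁻ x, ‖(f : Ω →ₘ[μ] ℂ) x‖ₑ ∂μ ≤ E.kotheNorm 1 * ‖f‖ₑ := by
  calc ∫⁻ x, ‖(f : Ω →ₘ[μ] ℂ) x‖ₑ ∂μ
      = ∫⁻ x, ‖(f : Ω →ₘ[μ] ℂ) x * (1 : Ω →ₘ[μ] ℂ) x‖ₑ ∂μ := (lintegral_enorm_mul_one _).symm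
    _ ≤ ‖f‖ₑ * ‖(⟨1, h1⟩ : E.kotheDual.toSubmodule)‖ₑ := lintegral_enorm_mul_le f ⟨1, h1⟩
    _ = E.kotheNorm 1 * ‖f‖ₑ := by rw [enorm_kotheDual, mul_comm]

theorem integrable_of_one_mem_kotheDual (h1 : (1 : Ω →ₘ[μ] ℂ) ∈ E.kotheDual.toSubmodule)
    (f : E.toSubmodule) : Integrable (f : Ω →ₘ[μ] ℂ) μ :=
  ⟨(f : Ω →ₘ[μ] ℂ).aestronglyMeasurable,
    (lintegral_enorm_le_of_one_mem_kotheDual h1 f).trans_lt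
      (ENNReal.mul_lt_top h1 enorm_lt_top)⟩

theorem lintegral_enorm_le_of_tendsto_one {a : ℕ → E.toSubmodule} {C : ℝ≥0∞}
    (ha : ∀ n, ‖a n‖ₑ ≤ C)
    (hlim : ∀ᵐ x ∂μ, Tendsto (fun n => (a n : Ω →ₘ[μ] ℂ) x) atTop (𝓝 1))
    (g : E.kotheDual.toSubmodule) :
    ∫⁻ x, ‖(g : Ω →ₘ[μ] ℂ) x‖ₑ ∂μ ≤ C * ‖g‖ₑ := by
  calc ∫⁻ x, ‖(g : Ω →ₘ[μ] ℂ) x‖ₑ ∂μ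
      = ∫⁻ x, liminf (fun n => ‖(a n : Ω →ₘ[μ] ℂ) x * (g : Ω →ₘ[μ] ℂ) x‖ₑ) atTop ∂μ := by
        refine lintegral_congr_ae ?_
        filter_upwards [hlim] with x hx
        have := (hx.mul_const ((g : Ω →ₘ[μ] ℂ) x)).enorm.liminf_eq
        rw [this, one_mul]
    _ ≤ liminf (fun n => ∫⁻ x, ‖(a n : Ω →ₘ[μ] ℂ) x * (g : Ω →ₘ[μ] ℂ) x‖ₑ ∂μ) atTop :=
        lintegral_liminf_le fun n =>
          ((a n : Ω →ₘ[μ] ℂ).measurable.mul (g : Ω →ₘ[μ] ℂ).measurable).enorm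
    _ ≤ liminf (fun _ : ℕ => C * ‖g‖ₑ) atTop :=
        liminf_le_liminf (Eventually.of_forall fun n =>
          (lintegral_enorm_mul_le (a n) g).trans (by gcongr; exact ha n))
    _ = C * ‖g‖ₑ := liminf_const _

end KotheDual

section BanachFunctionSpace

variable {Ω : Type u} [MeasurableSpace Ω] {μ : Measure Ω} {E : SeminormedFunctionSpace μ}

theorem IsBanachFunctionSpace.ae_norm_le_of_tendsto (hB : E.IsBanachFunctionSpace) {ι : Type*}
    {l : Filter ι} [l.NeBot] {s : ι → E.toSubmodule} {f : E.toSubmodule}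
    (hs : Tendsto s l (𝓝 f)) {t : Ω →ₘ[μ] ℂ}
    (ht : ∀ᶠ i in l, ∀ᵐ x ∂μ, ‖t x‖ ≤ ‖(s i : Ω →ₘ[μ] ℂ) x‖) :
    ∀ᵐ x ∂μ, ‖t x‖ ≤ ‖(f : Ω →ₘ[μ] ℂ) x‖ := by
  let excess : Ω → ℝ := fun x => max 0 (‖t x‖ - ‖(f : Ω →ₘ[μ] ℂ) x‖)
  have hexcess : AEStronglyMeasurable (fun x => (excess x : ℂ)) μ :=
    (Complex.measurable_ofReal.comp (measurable_const.max
      (t.measurable.norm.sub (f : Ω →ₘ[μ] ℂ).measurable.norm))).aestronglyMeasurable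
  have hle : ∀ᶠ i in l, ∀ᵐ x ∂μ,
      ‖(excess x : ℂ)‖ ≤ ‖((s i - f : E.toSubmodule) : Ω →ₘ[μ] ℂ) x‖ := by
    filter_upwards [ht] with i hi
    filter_upwards [hi, AEEqFun.coeFn_sub (s i : Ω →ₘ[μ] ℂ) (f : Ω →ₘ[μ] ℂ)] with x hx hsub
    rw [Submodule.coe_sub, hsub, Pi.sub_apply, Complex.norm_real,
      Real.norm_of_nonneg (le_max_left _ _)]
    exact max_le (norm_nonneg _) ((sub_le_sub_right hx _).trans (norm_sub_norm_le _ _))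
  obtain ⟨i, hi⟩ := hle.exists
  obtain ⟨p, hp, -⟩ := hB.isSolid.exists_coeFn_ae_eq hexcess _ hi
  have hnorm : ∀ᶠ i in l, ‖p‖ ≤ ‖s i - f‖ := by
    filter_upwards [hle] with i hi
    refine hB.norm_le_of_abs_le _ _ ?_
    filter_upwards [hi, hp] with x hx hpx
    rwa [hpx]
  obtain rfl : p = 0 := hB.eq_zero_of_norm_eq_zero p (le_antisymm
    (ge_of_tendsto (tendsto_iff_norm_sub_tendsto_zero.1 hs) hnorm) (norm_nonneg p))
  filter_upwards [hp, AEEqFun.coeFn_zero (α := Ω) (β := ℂ) (μ := μ)] with x hx hzero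
  rw [Submodule.coe_zero, hzero, Pi.zero_apply, eq_comm, Complex.ofReal_eq_zero] at hx
  exact sub_nonpos.1 ((le_max_right _ _).trans_eq hx)

theorem IsBanachFunctionSpace.exists_forall_ae_norm_le (hB : E.IsBanachFunctionSpace)
    {f : ℕ → E.toSubmodule} (hf : Summable fun n => ‖f n‖) :
    ∃ F : E.toSubmodule, ∀ n, ∀ᵐ x ∂μ, ‖(f n : Ω →ₘ[μ] ℂ) x‖ ≤ ‖(F : Ω →ₘ[μ] ℂ) x‖ := by
  choose g hg hgf using fun n => hB.isSolid.exists_coeFn_ae_eq_norm (f n)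
  have := hB.completeSpace
  obtain ⟨F, hF⟩ : Summable g := .of_norm_bounded hf hgf
  refine ⟨F, fun n => hB.ae_norm_le_of_tendsto hF.tendsto_sum_nat ?_⟩
  filter_upwards [eventually_gt_atTop n] with N hN
  rw [Submodule.coe_sum]
  filter_upwards [coeFn_sum_ae_eq (fun k => (g k : Ω →ₘ[μ] ℂ)) (Finset.range N),
    ae_all_iff.2 hg] with x hsum hx
  rw [hsum]
  simp_rw [hx]
  rw [← Complex.ofReal_sum, Complex.norm_real, Real.norm_of_nonneg (by positivity)]
  exact Finset.single_le_sum (f := fun k => ‖(f k : Ω →ₘ[μ] ℂ) x‖) (fun k _ => norm_nonneg _)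
    (Finset.mem_range.2 hN)

theorem IsBanachFunctionSpace.exists_measure_lt_norm_le [IsFiniteMeasure μ]
    (hB : E.IsBanachFunctionSpace) {ε : ℝ≥0∞} (hε : ε ≠ 0) :
    ∃ M : ℝ, ∀ f : E.toSubmodule, ‖f‖ ≤ 1 → μ {x | M < ‖(f : Ω →ₘ[μ] ℂ) x‖} ≤ ε := by
  -- Otherwise some `f n` in the unit ball exceeds `4 ^ n` on a set of measure `> ε`, and an `F`
  -- that dominates all `2⁻ⁿ f n` exceeds every `2 ^ n` on such a set.
  by_contra! hcon
  choose f hf hlarge using fun n : ℕ => hcon (4 ^ n)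
  let h : ℕ → E.toSubmodule := fun n => ((1 / 2) ^ n : ℂ) • f n
  have hsum : Summable fun n => ‖h n‖ := by
    refine summable_geometric_two.of_nonneg_of_le (fun n => norm_nonneg _) fun n => ?_
    rw [norm_smul, norm_pow, norm_div, norm_one, Complex.norm_ofNat]
    exact mul_le_of_le_one_right (by positivity) (hf n)
  obtain ⟨F, hF⟩ := hB.exists_forall_ae_norm_le hsum
  have hεF (n : ℕ) : ε ≤ μ {x | 2 ^ n < ‖(F : Ω →ₘ[μ] ℂ) x‖} := by
    refine (hlarge n).le.trans (measure_mono_ae ?_)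
    have hcoe : ⇑(h n : Ω →ₘ[μ] ℂ) =ᵐ[μ] ((1 / 2) ^ n : ℂ) • ⇑(f n : Ω →ₘ[μ] ℂ) :=
      AEEqFun.coeFn_smul _ _
    filter_upwards [hF n, hcoe]
      with x hx hsmul (hfx : 4 ^ n < ‖(f n : Ω →ₘ[μ] ℂ) x‖)
    calc (2 : ℝ) ^ n = (1 / 2) ^ n * 4 ^ n := by rw [← mul_pow]; norm_num
      _ < (1 / 2) ^ n * ‖(f n : Ω →ₘ[μ] ℂ) x‖ := by gcongr
      _ = ‖(h n : Ω →ₘ[μ] ℂ) x‖ := by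
        rw [hsmul, Pi.smul_apply, norm_smul, norm_pow, norm_div, norm_one, Complex.norm_ofNat]
      _ ≤ ‖(F : Ω →ₘ[μ] ℂ) x‖ := hx
  have hzero : Tendsto (fun n : ℕ => μ {x | (2 : ℝ) ^ n < ‖(F : Ω →ₘ[μ] ℂ) x‖}) atTop (𝓝 0) :=
    (tendsto_measure_lt_norm_atTop (F : Ω →ₘ[μ] ℂ).aemeasurable).comp
      (tendsto_pow_atTop_atTop_of_one_lt one_lt_two)
  exact hε (nonpos_iff_eq_zero.1 (ge_of_tendsto' hzero hεF))

theorem FatouProperty.exists_forall_ae_le_norm (hF : E.FatouProperty) {φ : ℕ → Ω → ℝ}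
    (hφ_nonneg : ∀ n x, 0 ≤ φ n x) (hφ_mono : Monotone φ) {u : ℕ → E.toSubmodule}
    (hu : ∀ n, (u n : Ω →ₘ[μ] ℂ) =ᵐ[μ] fun x => (φ n x : ℂ)) {C : ℝ} (hC : ∀ n, ‖u n‖ ≤ C) :
    ∃ w : E.toSubmodule, ∀ n, ∀ᵐ x ∂μ, φ n x ≤ ‖(w : Ω →ₘ[μ] ℂ) x‖ := by
  obtain ⟨w, hw, -⟩ := hF (ULift.{u} ℕ) (fun n => u n.down)
    (fun n => by
      rw [← AEEqFun.coeFn_le]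
      filter_upwards [hu n.down, AEEqFun.coeFn_zero (α := Ω) (β := ℂ) (μ := μ)] with x hx hzero
      rw [hx, hzero]
      exact Complex.zero_le_real.2 (hφ_nonneg _ _))
    (fun m n hmn => by
      rw [← AEEqFun.coeFn_le]
      filter_upwards [hu m.down, hu n.down] with x hm hn
      rw [hm, hn]
      exact Complex.real_le_real.2 (hφ_mono hmn x))
    ⟨C, Set.forall_mem_range.2 fun n => hC _⟩
  refine ⟨w, fun n => ?_⟩
  filter_upwards [AEEqFun.coeFn_le.2 (hw.1 ⟨⟨n⟩, rfl⟩), hu n] with x hle hx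
  rw [hx] at hle
  exact (Complex.le_def.1 hle).1.trans (Complex.re_le_norm _)

theorem FatouProperty.mem_of_tendsto_ae (hF : E.FatouProperty) (hE : E.IsSolid)
    {a : ℕ → E.toSubmodule} {C : ℝ} (ha : ∀ n, ‖a n‖ ≤ C) {f : Ω →ₘ[μ] ℂ}
    (hlim : ∀ᵐ x ∂μ, Tendsto (fun n => (a n : Ω →ₘ[μ] ℂ) x) atTop (𝓝 (f x))) :
    f ∈ E.toSubmodule := by
  let tail (n : ℕ) (x : Ω) : ℝ := ⨅ k, ‖(a (n + k) : Ω →ₘ[μ] ℂ) x‖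
  have htail_nonneg (n x) : 0 ≤ tail n x := Real.iInf_nonneg fun _ => norm_nonneg _
  have htail_le (n k x) : tail n x ≤ ‖(a (n + k) : Ω →ₘ[μ] ℂ) x‖ :=
    ciInf_le ⟨0, Set.forall_mem_range.2 fun _ => norm_nonneg _⟩ k
  have htail_mono : Monotone tail := fun m n hmn x => le_ciInf fun k => by
    obtain ⟨d, rfl⟩ := Nat.exists_eq_add_of_le hmn
    simpa only [add_assoc] using htail_le m (d + k) x
  have htail_meas (n) : Measurable (tail n) :=
    Measurable.iInf fun k => (a (n + k) : Ω →ₘ[μ] ℂ).measurable.norm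
  choose u hu hua using fun n => hE.exists_coeFn_ae_eq
    (Complex.measurable_ofReal.comp (htail_meas n)).aestronglyMeasurable (a n)
    (ae_of_all _ fun x => (Complex.norm_of_nonneg (htail_nonneg n x)).trans_le (htail_le n 0 x))
  obtain ⟨w, hw⟩ := hF.exists_forall_ae_le_norm htail_nonneg htail_mono hu
    fun n => (hua n).trans (ha n)
  refine (hE f w ?_).1
  filter_upwards [ae_all_iff.2 hw, hlim] with x hx hax
  exact le_of_tendsto' (tendsto_iInf_add_atTop hax.norm) hx

end BanachFunctionSpace

section TranslationInvariant

variable {G : Type u} [AddCommGroup G] [TopologicalSpace G] [IsTopologicalAddGroup G]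
  [CompactSpace G] [MeasurableSpace G] [BorelSpace G]
  {μ : Measure G} [μ.IsAddHaarMeasure] [μ.Regular] [IsProbabilityMeasure μ]
  {E : SeminormedFunctionSpace μ}

theorem TranslationInvariant.exists_seq_tendsto_integral (hinv : E.TranslationInvariant)
    {f : E.toSubmodule} (hf : Integrable (f : G →ₘ[μ] ℂ) μ) :
    ∃ a : ℕ → E.toSubmodule, (∀ n, ‖a n‖ ≤ ‖f‖) ∧ ∀ᵐ x ∂μ,
      Tendsto (fun n => (a n : G →ₘ[μ] ℂ) x) atTop (𝓝 (∫ x, (f : G →ₘ[μ] ℂ) x ∂μ)) := by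
  let fL : Lp ℂ 1 μ := ⟨f, Lp.mem_Lp_iff_memLp.2 (memLp_one_iff_integrable.2 hf)⟩
  let S : Set (Lp ℂ 1 μ) := {v | ∃ e : E.toSubmodule, (e : G →ₘ[μ] ℂ) = v ∧ ‖e‖ ≤ ‖f‖}
  have hS : Convex ℝ S := by
    rintro v ⟨e, he, hef⟩ v' ⟨e', he', hef'⟩ s t hs ht hst
    refine ⟨(s : ℂ) • e + (t : ℂ) • e', ?_, ?_⟩
    · rw [Submodule.coe_add, Submodule.coe_smul, Submodule.coe_smul, he, he']
      rfl
    · calc ‖(s : ℂ) • e + (t : ℂ) • e'‖ ≤ s * ‖e‖ + t * ‖e'‖ := by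
            refine (norm_add_le _ _).trans_eq ?_
            rw [norm_smul, norm_smul, Complex.norm_of_nonneg hs, Complex.norm_of_nonneg ht]
        _ ≤ s * ‖f‖ + t * ‖f‖ := by gcongr
        _ = ‖f‖ := by rw [← add_mul, hst, one_mul]
  have htranslate (y : G) : translateLp y fL ∈ S :=
    let ⟨hmem, hnorm⟩ := hinv y f
    ⟨⟨_, hmem⟩, rfl, hnorm.le⟩
  obtain ⟨v, hvS, hv⟩ := mem_closure_iff_seq_limit.1 (const_integral_mem_closure hS htranslate)
  obtain ⟨ns, -, hae⟩ := (tendstoInMeasure_of_tendsto_Lp hv).exists_seq_tendsto_ae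
  choose a ha haf using fun n => hvS (ns n)
  refine ⟨a, haf, ?_⟩
  filter_upwards [hae, Lp.coeFn_const (p := 1) (μ := μ) (∫ x, fL x ∂μ)] with x hx hconst
  simp_rw [ha]
  rwa [hconst] at hx

theorem IsBanachFunctionSpace.exists_norm_integral_le (hB : E.IsBanachFunctionSpace)
    (hinv : E.TranslationInvariant) :
    ∃ M : ℝ, ∀ f : E.toSubmodule, ‖f‖ ≤ 1 → Integrable (f : G →ₘ[μ] ℂ) μ →
      ‖∫ x, (f : G →ₘ[μ] ℂ) x ∂μ‖ ≤ M := by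
  obtain ⟨M, hM⟩ := hB.exists_measure_lt_norm_le (ε := 2⁻¹)
    (ENNReal.inv_ne_zero.2 ENNReal.ofNat_ne_top)
  refine ⟨M, fun f hf hfi => ?_⟩
  obtain ⟨a, haf, hlim⟩ := hinv.exists_seq_tendsto_integral hfi
  exact norm_le_of_tendsto_ae_const (fun n => (a n : G →ₘ[μ] ℂ).aestronglyMeasurable) hlim
    ENNReal.one_half_lt_one fun n => hM (a n) ((haf n).trans hf)

theorem IsBanachFunctionSpace.one_mem_kotheDual (hB : E.IsBanachFunctionSpace)
    (hinv : E.TranslationInvariant) : (1 : G →ₘ[μ] ℂ) ∈ E.kotheDual.toSubmodule := by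
  obtain ⟨M, hM⟩ := hB.exists_norm_integral_le hinv
  refine (iSup₂_le fun f hf => ?_ : E.kotheNorm 1 ≤ ENNReal.ofReal M).trans_lt
    ENNReal.ofReal_lt_top
  rw [lintegral_enorm_mul_one]
  exact hB.isSolid.lintegral_enorm_le_of_forall_norm_integral_le hM hf

theorem IsBanachFunctionSpace.exists_seq_tendsto_one (hB : E.IsBanachFunctionSpace)
    (hE : E.toSubmodule ≠ ⊥) (hinv : E.TranslationInvariant) :
    ∃ (C : ℝ) (a : ℕ → E.toSubmodule), (∀ n, ‖a n‖ ≤ C) ∧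
      ∀ᵐ x ∂μ, Tendsto (fun n => (a n : G →ₘ[μ] ℂ) x) atTop (𝓝 1) := by
  obtain ⟨g, hg, hg0⟩ := Submodule.exists_mem_ne_zero_of_ne_bot hE
  obtain ⟨e, he, -⟩ := hB.isSolid.exists_coeFn_ae_eq_norm ⟨g, hg⟩
  have hone := hB.one_mem_kotheDual hinv
  have hmean : ∫ x, (e : G →ₘ[μ] ℂ) x ∂μ ≠ 0 := by
    rw [integral_congr_ae he, integral_complex_ofReal, Complex.ofReal_ne_zero, Ne,
      integral_eq_zero_iff_of_nonneg (fun x => norm_nonneg _)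
        (integrable_of_one_mem_kotheDual hone ⟨g, hg⟩).norm]
    refine fun hzero => hg0 (AEEqFun.ext ?_)
    filter_upwards [hzero, AEEqFun.coeFn_zero (α := G) (β := ℂ) (μ := μ)] with x hx h0
    rw [h0]
    exact norm_eq_zero.1 hx
  obtain ⟨a, hae, hlim⟩ :=
    hinv.exists_seq_tendsto_integral (integrable_of_one_mem_kotheDual hone e)
  set c : ℂ := ∫ x, (e : G →ₘ[μ] ℂ) x ∂μ
  refine ⟨‖c⁻¹‖ * ‖e‖, fun n => c⁻¹ • a n, fun n => ?_, ?_⟩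
  · rw [norm_smul]
    gcongr
    exact hae n
  · filter_upwards [hlim, ae_all_iff.2 fun n => AEEqFun.coeFn_smul c⁻¹ (a n : G →ₘ[μ] ℂ)]
      with x hx hsmul
    simpa only [Submodule.coe_smul, hsmul, Pi.smul_apply, smul_eq_mul, inv_mul_cancel₀ hmean]
      using hx.const_mul c⁻¹

end TranslationInvariant

end SeminormedFunctionSpace

theorem corollary3p5_general {G : Type u} [AddCommGroup G] [TopologicalSpace G]
    [IsTopologicalAddGroup G] [CompactSpace G] [MeasurableSpace G] [BorelSpace G]
    (μ : Measure G) [μ.IsAddHaarMeasure] [μ.Regular] [IsProbabilityMeasure μ]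
    (E : SeminormedFunctionSpace μ)
    (hB : E.IsBanachFunctionSpace) (hE : E.toSubmodule ≠ ⊥) (hinv : E.TranslationInvariant) :
    ((lpFunctionSpace ∞ μ).ContinuouslyIncluded E.kotheDual ∧
      E.kotheDual.ContinuouslyIncluded (lpFunctionSpace 1 μ)) ∧
    E.ContinuouslyIncluded (lpFunctionSpace 1 μ) ∧
    (E.FatouProperty → (lpFunctionSpace ∞ μ).ContinuouslyIncluded E) := by
  have hone := hB.one_mem_kotheDual hinv
  obtain ⟨C, a, ha, hlim⟩ := hB.exists_seq_tendsto_one hE hinv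
  refine ⟨⟨?_, ?_⟩, ?_, fun hF => ?_⟩
  · exact E.isSolid_kotheDual.lpFunctionSpace_top_continuouslyIncluded hone
  · refine SeminormedFunctionSpace.continuouslyIncluded_lpFunctionSpace_one
      (C := ENNReal.ofReal C) ENNReal.ofReal_ne_top
      (SeminormedFunctionSpace.lintegral_enorm_le_of_tendsto_one (fun n => ?_) hlim)
    rw [← ofReal_norm]
    exact ENNReal.ofReal_le_ofReal (ha n)
  · exact SeminormedFunctionSpace.continuouslyIncluded_lpFunctionSpace_one (ne_of_lt hone)
      (SeminormedFunctionSpace.lintegral_enorm_le_of_one_mem_kotheDual hone)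
  · refine hB.isSolid.lpFunctionSpace_top_continuouslyIncluded
      (hF.mem_of_tendsto_ae hB.isSolid ha ?_)
    filter_upwards [hlim, AEEqFun.coeFn_one (α := G) (β := ℂ) (μ := μ)] with x hx hx1
    rwa [hx1]

theorem corollary3p5 {G : Type u} [AddCommGroup G] [TopologicalSpace G] [IsTopologicalAddGroup G]
    [CompactSpace G] [T2Space G] [Infinite G] [MeasurableSpace G] [BorelSpace G]
    (μ : Measure G) [μ.IsAddHaarMeasure] [μ.Regular] [IsProbabilityMeasure μ]
    (E : SeminormedFunctionSpace μ)
    (hB : E.IsBanachFunctionSpace) (hE : E.toSubmodule ≠ ⊥) (hinv : E.TranslationInvariant) :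
    ((lpFunctionSpace ∞ μ).ContinuouslyIncluded E.kotheDual ∧
      E.kotheDual.ContinuouslyIncluded (lpFunctionSpace 1 μ)) ∧
    (E.FatouProperty →
      (lpFunctionSpace ∞ μ).ContinuouslyIncluded E ∧ E.ContinuouslyIncluded (lpFunctionSpace 1 μ)) :=
  let ⟨hdual, hL1, hFatou⟩ := corollary3p5_general μ E hB hE hinv
  ⟨hdual, fun hF => ⟨hFatou hF, hL1⟩⟩
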